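/- Let $\sigma_x,\sigma_y,\sigma_z$ be the Pauli matrices. For $\mathbf a\in\mathbb R^3$ with $|\mathbf a|\le 1$ let $\mathsf A^{\mathbf a}$ be the unbiased qubit observable with outcomes $\pm$ and effects $\mathsf A^{\mathbf a}(\pm)=\frac12(\mathbb 1\pm \mathbf a\cdot\boldsymbol\sigma)$. A pair of observables (POVMs) on $\mathbb C^2$ is compatible if both are marginals of one joint POVM on the product of the outcome sets, and incompatible otherwise. For a set $\mathcal S_0$ of qubit states (density matrices), a pair $\{\mathsf A_1,\mathsf A_2\}$ is $\mathcal S_0$-compatible if there is a compatible pair $\{\tilde{\mathsf A}_1,\tilde{\mathsf A}_2\}$ with the same outcome sets such that $\mathrm{Tr}[\rho\tilde{\mathsf A}_i(x)]=\mathrm{Tr}[\rho\mathsf A_i(x)]$ for $i=1,2$, all outcomes $x$ and all $\rho\in\mathcal S_0$; otherwise it is $\mathcal S_0$-incompatible. Write $\mathbb E\preceq_{\mathrm{inc}}\mathbb D$ if $\mathbb D$ is $\mathcal S_0$-incompatible for every set of states $\mathcal S_0$ for which $\mathbb E$ is $\mathcal S_0$-incompatible, and $\mathbb D\sim_{\mathrm{inc}}\mathbb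 E$ if $\mathbb D\preceq_{\mathrm{inc}}\mathbb E$ and $\mathbb E\preceq_{\mathrm{inc}}\mathbb D$. Theorem. Let $\mathbf x=(1,0,0)$, $\mathbf y=(0,1,0)$, and let $t\in[0,1]$ be such that the mutually unbiased pair $\mathbb A^t_{\mathrm{mub}}=\{\mathsf A^{t\mathbf x},\mathsf A^{t\mathbf y}\}$ is incompatible (that is, $t>1/\sqrt2$). Let $\mathbf b_1,\mathbf b_2\in\mathbb R^3$ with $|\mathbf b_1|,|\mathbf b_2|\le1$, and let $\mathbb B_{\mathrm{ub}}=\{\mathsf A^{\mathbf b_1},\mathsf A^{\mathbf b_2}\}$. If $\mathbb A^t_{\mathrm{mub}}\sim_{\mathrm{inc}}\mathbb B_{\mathrm{ub}}$, then $(\mathbf b_1,\mathbf b_2)=(\pm t\mathbf x,\pm t\mathbf y)$ or $(\mathbf b_1,\mathbf b_2)=(\pm t\mathbf y,\pm t\mathbf x)$, with independent signs. Conversely, $\mathbb A^t_{\mathrm{mub}}\sim_{\mathrm{inc}}\mathbb B_{\mathrm{ub}}$ holds for each of these $(\mathbf b_1,\mathbf b_2)$. -/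

import Mathlib

open scoped ComplexOrder

namespace QuantumIncompatibility

/-- The state space of the quantum system with Hilbert space `ℂ^d`: density matrices. -/
def stateSpace (d : Type*) [Fintype d] : Set (Matrix d d ℂ) :=
  {ρ | ρ.PosSemidef ∧ ρ.trace = 1}

/-- An observable on `ℂ^d` with finite outcome set `X`: a positive operator-valued measure. -/
structure Observable (d : Type*) [Fintype d] [DecidableEq d] (X : Type*) [Fintype X] where
  effect : X → Matrix d d ℂ
  posSemidef : ∀ x, (effect x).PosSemidef
  sum_eq_one : ∑ x, effect x = 1

/-- A finite family of observables (with finite outcome sets `X i`) is compatible, i.e. jointly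
measurable, if some observable with outcome set `∏ i, X i` has all of them as its marginals. -/
def Compatible {d : Type*} [Fintype d] [DecidableEq d] {ι : Type*} [Fintype ι] [DecidableEq ι]
    {X : ι → Type*} [∀ i, Fintype (X i)] [∀ i, DecidableEq (X i)]
    (A : ∀ i, Observable d (X i)) : Prop :=
  ∃ J : Observable d (∀ i, X i),
    ∀ (i : ι) (x : X i), (A i).effect x = ∑ f : ∀ i, X i with f i = x, J.effect f

/-- A family is incompatible if it is not compatible. -/
def Incompatible {d : Type*} [Fintype d] [DecidableEq d] {ι : Type*} [Fintype ι] [DecidableEq ι]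
    {X : ι → Type*} [∀ i, Fintype (X i)] [∀ i, DecidableEq (X i)]
    (A : ∀ i, Observable d (X i)) : Prop :=
  ¬ Compatible A

/-- For a set `S₀` of states, `A` is `S₀`-compatible if some compatible family (with the same
outcome sets) has the same outcome probabilities `Tr[ρ A i (x)]` as `A` on every state of `S₀`. -/
def CompatibleOn {d : Type*} [Fintype d] [DecidableEq d] {ι : Type*} [Fintype ι] [DecidableEq ι]
    {X : ι → Type*} [∀ i, Fintype (X i)] [∀ i, DecidableEq (X i)]
    (S₀ : Set (Matrix d d ℂ)) (A : ∀ i, Observable d (X i)) : Prop :=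
  ∃ A' : ∀ i, Observable d (X i), Compatible A' ∧
    ∀ (i : ι) (x : X i), ∀ ρ ∈ S₀,
      (ρ * (A' i).effect x).trace = (ρ * (A i).effect x).trace

/-- `S₀`-incompatibility: the incompatibility of `A` can be detected with states from `S₀`. -/
def IncompatibleOn {d : Type*} [Fintype d] [DecidableEq d] {ι : Type*} [Fintype ι] [DecidableEq ι]
    {X : ι → Type*} [∀ i, Fintype (X i)] [∀ i, DecidableEq (X i)]
    (S₀ : Set (Matrix d d ℂ)) (A : ∀ i, Observable d (X i)) : Prop :=
  ¬ CompatibleOn S₀ A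

/-- The operational preorder `B ≼_inc A`: every set of states that detects the incompatibility
of `B` also detects the incompatibility of `A`. -/
def PrecInc {d : Type*} [Fintype d] [DecidableEq d]
    {ι : Type*} [Fintype ι] [DecidableEq ι]
    {X : ι → Type*} [∀ i, Fintype (X i)] [∀ i, DecidableEq (X i)]
    {κ : Type*} [Fintype κ] [DecidableEq κ]
    {Y : κ → Type*} [∀ k, Fintype (Y k)] [∀ k, DecidableEq (Y k)]
    (B : ∀ k, Observable d (Y k)) (A : ∀ i, Observable d (X i)) : Prop :=
  ∀ S₀ ⊆ stateSpace d, IncompatibleOn S₀ B → IncompatibleOn S₀ A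

/-- The operational equivalence `A ∼_inc B`. -/
def EquivInc {d : Type*} [Fintype d] [DecidableEq d]
    {ι : Type*} [Fintype ι] [DecidableEq ι]
    {X : ι → Type*} [∀ i, Fintype (X i)] [∀ i, DecidableEq (X i)]
    {κ : Type*} [Fintype κ] [DecidableEq κ]
    {Y : κ → Type*} [∀ k, Fintype (Y k)] [∀ k, DecidableEq (Y k)]
    (A : ∀ i, Observable d (X i)) (B : ∀ k, Observable d (Y k)) : Prop :=
  PrecInc A B ∧ PrecInc B A

/-- The Pauli matrices. -/
def pauliX : Matrix (Fin 2) (Fin 2) ℂ := !![0, 1; 1, 0]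

def pauliY : Matrix (Fin 2) (Fin 2) ℂ := !![0, -Complex.I; Complex.I, 0]

def pauliZ : Matrix (Fin 2) (Fin 2) ℂ := !![1, 0; 0, -1]

/-- `a · σ = a_x σ_x + a_y σ_y + a_z σ_z`. -/
noncomputable def dotPauli (a : EuclideanSpace ℝ (Fin 3)) : Matrix (Fin 2) (Fin 2) ℂ :=
  (a 0 : ℂ) • pauliX + (a 1 : ℂ) • pauliY + (a 2 : ℂ) • pauliZ

/-- The effects `(1 ± a · σ) / 2`; the outcome `+` is `true` and the outcome `-` is `false`. -/
noncomputable def unbiasedEffect (a : EuclideanSpace ℝ (Fin 3)) :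
    Bool → Matrix (Fin 2) (Fin 2) ℂ
  | true => (1 / 2 : ℂ) • (1 + dotPauli a)
  | false => (1 / 2 : ℂ) • (1 - dotPauli a)

theorem norm_sq_fin_three (a : EuclideanSpace ℝ (Fin 3)) :
    ‖a‖ ^ 2 = a 0 ^ 2 + a 1 ^ 2 + a 2 ^ 2 := by
  simp [EuclideanSpace.norm_sq_eq, Fin.sum_univ_three]

theorem posSemidef_one_add_dotPauli (a : EuclideanSpace ℝ (Fin 3)) (ha : ‖a‖ ≤ 1) :
    ((1 / 2 : ℂ) • (1 + dotPauli a)).PosSemidef := by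
  have h1 : a 0 ^ 2 + a 1 ^ 2 + a 2 ^ 2 ≤ 1 := by
    rw [← norm_sq_fin_three]
    nlinarith [norm_nonneg a]
  set w : ℝ := Real.sqrt (1 - (a 0 ^ 2 + a 1 ^ 2 + a 2 ^ 2)) with hw
  have hw0 : 0 ≤ w := Real.sqrt_nonneg _
  have hw2 : w ^ 2 = 1 - (a 0 ^ 2 + a 1 ^ 2 + a 2 ^ 2) := Real.sq_sqrt (by linarith)
  have hv : 0 < 4 * (1 + w) := by positivity
  -- `2 (1 + w) (1 + a·σ) = (1 + w + a·σ)²`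
  have key : (1 / 2 : ℂ) • (1 + dotPauli a) =
      ((4 * (1 + w))⁻¹ : ℝ) •
        ((((1 + w : ℝ) : ℂ) • (1 : Matrix (Fin 2) (Fin 2) ℂ) + dotPauli a) *
        (((1 + w : ℝ) : ℂ) • (1 : Matrix (Fin 2) (Fin 2) ℂ) + dotPauli a).conjTranspose) := by
    have hv' : (1 + (w : ℂ)) ≠ 0 := by exact_mod_cast (by positivity : (1 + w) ≠ 0)
    have hw2' : (w : ℂ) ^ 2 = 1 - ((a 0 : ℂ) ^ 2 + (a 1 : ℂ) ^ 2 + (a 2 : ℂ) ^ 2) := by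
      exact_mod_cast hw2
    have hI := Complex.I_sq
    ext i j
    fin_cases i <;> fin_cases j <;>
      simp [dotPauli, pauliX, pauliY, pauliZ, Matrix.mul_apply, Fin.sum_univ_two] <;>
      field_simp <;> grind
  rw [key]
  exact (Matrix.posSemidef_self_mul_conjTranspose _).smul (by positivity)

theorem dotPauli_neg (a : EuclideanSpace ℝ (Fin 3)) : dotPauli (-a) = -dotPauli a := by
  simp [dotPauli]
  abel

/-- The unbiased qubit observable with Bloch vector `a`, `|a| ≤ 1`. -/
noncomputable def unbiasedObs (a : EuclideanSpace ℝ (Fin 3)) (ha : ‖a‖ ≤ 1) :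
    Observable (Fin 2) Bool where
  effect := unbiasedEffect a
  posSemidef := by
    intro x
    cases x
    · have h := posSemidef_one_add_dotPauli (-a) (by simpa using ha)
      rwa [dotPauli_neg, ← sub_eq_add_neg] at h
    · exact posSemidef_one_add_dotPauli a ha
  sum_eq_one := by
    rw [Fintype.sum_bool]
    simp only [unbiasedEffect]
    rw [← smul_add, add_add_sub_cancel, ← two_smul ℂ, smul_smul]
    norm_num

/-- A pair of unbiased qubit observables. -/
noncomputable def unbiasedPair (a₁ a₂ : EuclideanSpace ℝ (Fin 3)) (h₁ : ‖a₁‖ ≤ 1)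
    (h₂ : ‖a₂‖ ≤ 1) : Fin 2 → Observable (Fin 2) Bool :=
  ![unbiasedObs a₁ h₁, unbiasedObs a₂ h₂]

/-- The unit vectors along the `x` and `y` axes. -/
noncomputable def xHat : EuclideanSpace ℝ (Fin 3) := !₂[1, 0, 0]

noncomputable def yHat : EuclideanSpace ℝ (Fin 3) := !₂[0, 1, 0]

theorem norm_smul_xHat_le {t : ℝ} (ht : t ∈ Set.Icc (0 : ℝ) 1) : ‖t • xHat‖ ≤ 1 := by
  have h : ‖xHat‖ = 1 := by simp [xHat, EuclideanSpace.norm_eq, Fin.sum_univ_three]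
  rw [norm_smul, h, Real.norm_of_nonneg ht.1, mul_one]
  exact ht.2

theorem norm_smul_yHat_le {t : ℝ} (ht : t ∈ Set.Icc (0 : ℝ) 1) : ‖t • yHat‖ ≤ 1 := by
  have h : ‖yHat‖ = 1 := by simp [yHat, EuclideanSpace.norm_eq, Fin.sum_univ_three]
  rw [norm_smul, h, Real.norm_of_nonneg ht.1, mul_one]
  exact ht.2

/-- The mutually unbiased pair with Bloch vectors `t x` and `t y`, `0 ≤ t ≤ 1`. -/
noncomputable def mubPair (t : ℝ) (ht : t ∈ Set.Icc (0 : ℝ) 1) :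
    Fin 2 → Observable (Fin 2) Bool :=
  unbiasedPair (t • xHat) (t • yHat) (norm_smul_xHat_le ht) (norm_smul_yHat_le ht)

end QuantumIncompatibility

open QuantumIncompatibility

/-!
Identify a state with its Bloch vector and write `c = b₁ + b₂`, `d = b₁ - b₂`. For a unit vector `n`
let `P` be the orthogonal projection onto the plane `n⊥`. The states whose Bloch vectors lie in `n⊥`
form an equatorial disc, and the unbiased pair with Bloch vectors `b₁`, `b₂` is compatible on this
disc exactly when `|P c| + |P d| ≤ 2` (`compatibleOn_equatorialDisc_iff`). Sufficiency is Busch's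
joint observable for the pair `P b₁`, `P b₂`, which agrees with the given one on the disc. For
necessity, a joint observable `E` of any pair that agrees on the disc satisfies
`A₁(+) + A₂(+) - 1 = E(++) - E(--)` and `A₁(+) - A₂(+) = E(+-) - E(-+)`, and
`|Tr[(r·σ) E(ij)]| ≤ |r| Tr[E(ij)]` bounds `|P c| + |P d|` by `Tr 1 = 2`.

Equivalent pairs therefore have the same set of unit normals `n` with `|P c| + |P d| > 2`, and these
discs alone determine the pair. In the orthonormal basis `(1,1,0)/√2`, `(1,-1,0)/√2`, `(0,0,1)` the
mutually unbiased pair has `|P c| + |P d| = √2 t (√(1-U²) + √(1-V²))` at `n = (U, V, W)`. The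
boundary of its detection region is the curve `√(1-U²) + √(1-V²) = k` with `k = √2/t ∈ [√2, 2)`, and
by continuity `|P c| + |P d| = 2` holds for the second pair along this curve
(`projLength_add_eq_two_of_boundary`). Eliminating radicals gives a quartic in `(U, V, W)` that
vanishes on the curve. The curve is invariant under reflections, so the even part of the quartic and
the coefficients of `UV`, `UW`, `VW` vanish separately (`separate_signs`). With `√(1-U²) = k/2 + h`
and `√(1-V²) = k/2 - h` each of them is a polynomial in `h` with an interval of zeros, so its
coefficients vanish (`coefficient_relations`). The resulting equations say that `c` and `d` lie along
the two diagonals, one along each, and have length `√2 t` (`axes_of_diagonal`).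

The converse holds because changing the sign of a Bloch vector relabels the outcomes, and
(in)compatibility on any set of states is insensitive to relabelling outcomes and to permuting the
observables (`EquivInc.of_relabel`).
-/

namespace QuantumIncompatibility

open scoped RealInnerProductSpace

/-! ### Spin matrices -/

theorem dotPauli_add (a b : EuclideanSpace ℝ (Fin 3)) :
    dotPauli (a + b) = dotPauli a + dotPauli b := by
  simp only [dotPauli, PiLp.add_apply, Complex.ofReal_add, add_smul]
  abel

theorem dotPauli_smul (s : ℝ) (a : EuclideanSpace ℝ (Fin 3)) :
    dotPauli (s • a) = (s : ℂ) • dotPauli a := by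
  simp only [dotPauli, PiLp.smul_apply, smul_eq_mul, Complex.ofReal_mul, smul_add, smul_smul]

theorem dotPauli_zero : dotPauli 0 = 0 := by
  simp [dotPauli]

theorem trace_dotPauli (a : EuclideanSpace ℝ (Fin 3)) : (dotPauli a).trace = 0 := by
  simp [dotPauli, pauliX, pauliY, pauliZ, Matrix.trace_fin_two]

theorem trace_dotPauli_mul_dotPauli (a b : EuclideanSpace ℝ (Fin 3)) :
    (dotPauli a * dotPauli b).trace = 2 * (⟪a, b⟫ : ℝ) := by
  have hI := Complex.I_sq
  simp [dotPauli, pauliX, pauliY, pauliZ, Matrix.trace_fin_two,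
    PiLp.inner_apply, Fin.sum_univ_three]
  grind

theorem posSemidef_smul_one_add_dotPauli {x : ℝ} {v : EuclideanSpace ℝ (Fin 3)} (h : ‖v‖ ≤ x) :
    ((x : ℂ) • (1 : Matrix (Fin 2) (Fin 2) ℂ) + dotPauli v).PosSemidef := by
  rcases (le_trans (norm_nonneg v) h).eq_or_lt with hx | hx
  · have hv : v = 0 := norm_le_zero_iff.mp (hx ▸ h)
    subst hv
    subst hx
    simpa [dotPauli_zero] using (Matrix.PosSemidef.zero : (0 : Matrix (Fin 2) (Fin 2) ℂ).PosSemidef)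
  · have hn : ‖x⁻¹ • v‖ ≤ 1 := by
      rw [norm_smul, norm_inv, Real.norm_of_nonneg hx.le, inv_mul_le_iff₀ hx]
      simpa using h
    have := (posSemidef_one_add_dotPauli _ hn).smul (show 0 ≤ 2 * x by positivity)
    convert this using 1
    have hx' : (x : ℂ) ≠ 0 := by exact_mod_cast hx.ne'
    rw [dotPauli_smul]
    ext i j
    simp
    field_simp

open scoped MatrixOrder Matrix.Norms.L2Operator in
theorem trace_mul_nonneg {d : Type*} [Fintype d] [DecidableEq d] {A B : Matrix d d ℂ}
    (hA : A.PosSemidef) (hB : B.PosSemidef) : 0 ≤ (A * B).trace := by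
  obtain ⟨X, rfl⟩ := CStarAlgebra.nonneg_iff_eq_star_mul_self.mp hB.nonneg
  rw [← mul_assoc, Matrix.trace_mul_comm, ← mul_assoc]
  exact (hA.mul_mul_conjTranspose_same X).trace_nonneg

/-- The expectation value of `r·σ` in an unnormalized state is at most `|r|` times the trace, as the
eigenvalues of `r·σ` are `±|r|`. -/
theorem trace_dotPauli_mul_le {E : Matrix (Fin 2) (Fin 2) ℂ} (hE : E.PosSemidef)
    (r : EuclideanSpace ℝ (Fin 3)) : (dotPauli r * E).trace.re ≤ ‖r‖ * E.trace.re := by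
  have h := posSemidef_smul_one_add_dotPauli (x := ‖r‖) (v := -r) (by simp)
  have h2 : 0 ≤ (((‖r‖ : ℂ) • (1 : Matrix (Fin 2) (Fin 2) ℂ) + dotPauli (-r)) * E).trace :=
    trace_mul_nonneg h hE
  rw [dotPauli_neg, add_mul, Matrix.trace_add] at h2
  have := (Complex.le_def.mp h2).1
  simp at this
  linarith

/-! ### Compatibility on equatorial discs -/

theorem sum_finTwoArrow {M : Type*} [AddCommMonoid M] (F : (Fin 2 → Bool) → M) : ∑ f, F f =
    F ![true, true] + F ![true, false] + F ![false, true] + F ![false, false] := by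
  rw [← (finTwoArrowEquiv Bool).symm.sum_comp, Fintype.sum_prod_type]
  simp [add_assoc]

/-- The sufficient half of Busch's criterion: the joint observable has effects
`((1 + i j g) 1 + (i a₁ + j a₂)·σ) / 4` for `i, j = ±1`, with `g = |a₁ + a₂| - 1`. -/
theorem compatible_unbiasedPair {a₁ a₂ : EuclideanSpace ℝ (Fin 3)} (h₁ : ‖a₁‖ ≤ 1)
    (h₂ : ‖a₂‖ ≤ 1) (h : ‖a₁ + a₂‖ + ‖a₁ - a₂‖ ≤ 2) :
    Compatible (unbiasedPair a₁ a₂ h₁ h₂) := by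
  set g : ℝ := ‖a₁ + a₂‖ - 1 with hg
  have e1 : ‖-(a₁ + a₂)‖ ≤ 1 + g := by rw [norm_neg]; linarith
  let s : Bool → ℝ := fun b => if b then 1 else -1
  let J : (Fin 2 → Bool) → Matrix (Fin 2) (Fin 2) ℂ := fun f =>
    (1 / 4 : ℝ) • (((1 + s (f 0) * s (f 1) * g : ℝ) : ℂ) • (1 : Matrix (Fin 2) (Fin 2) ℂ) +
      dotPauli (s (f 0) • a₁ + s (f 1) • a₂))
  refine ⟨⟨J, ?_, ?_⟩, ?_⟩
  · intro f
    refine (posSemidef_smul_one_add_dotPauli ?_).smul (by norm_num)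
    rcases h0 : f 0 <;> rcases h1 : f 1 <;> simp [s]
    · rw [← neg_add]
      exact e1
    · rw [neg_add_eq_sub, norm_sub_rev]
      linarith
    · rw [← sub_eq_add_neg]; linarith
    · linarith
  · rw [sum_finTwoArrow]
    simp only [J, s, dotPauli_add, dotPauli_smul]
    ext i j
    simp
    ring
  · intro i x
    rw [Finset.sum_filter, sum_finTwoArrow]
    fin_cases i <;> cases x <;>
      simp [unbiasedPair, unbiasedObs, unbiasedEffect, J, s, dotPauli_add, dotPauli_neg] <;>
      (ext i j; simp; ring)

/-- The states whose Bloch vectors are orthogonal to `n`. -/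
def equatorialDisc (n : EuclideanSpace ℝ (Fin 3)) : Set (Matrix (Fin 2) (Fin 2) ℂ) :=
  {ρ | ∃ r : EuclideanSpace ℝ (Fin 3), ‖r‖ ≤ 1 ∧ ⟪r, n⟫ = 0 ∧
    ρ = (1 / 2 : ℂ) • (1 + dotPauli r)}

theorem equatorialDisc_subset (n : EuclideanSpace ℝ (Fin 3)) :
    equatorialDisc n ⊆ stateSpace (Fin 2) := by
  rintro ρ ⟨r, hr, -, rfl⟩
  refine ⟨posSemidef_one_add_dotPauli r hr, ?_⟩
  simp [trace_dotPauli]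

/-- The component of `v` orthogonal to `n`; the formula is the orthogonal projection onto the plane
`n⊥` only when `n` is a unit vector. -/
noncomputable def perpPart (n v : EuclideanSpace ℝ (Fin 3)) : EuclideanSpace ℝ (Fin 3) :=
  v - ⟪n, v⟫ • n

theorem perpPart_add (n v w : EuclideanSpace ℝ (Fin 3)) :
    perpPart n (v + w) = perpPart n v + perpPart n w := by
  simp only [perpPart, inner_add_right, add_smul]
  abel

theorem perpPart_sub (n v w : EuclideanSpace ℝ (Fin 3)) :
    perpPart n (v - w) = perpPart n v - perpPart n w := by
  simp only [perpPart, inner_sub_right, sub_smul]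
  abel

theorem inner_perpPart_self {n : EuclideanSpace ℝ (Fin 3)} (hn : ‖n‖ = 1)
    (v : EuclideanSpace ℝ (Fin 3)) : ⟪perpPart n v, n⟫ = 0 := by
  simp [perpPart, inner_sub_left, inner_smul_left, hn, real_inner_comm]

theorem inner_perpPart_of_orthogonal {n r : EuclideanSpace ℝ (Fin 3)} (hr : ⟪r, n⟫ = 0)
    (v : EuclideanSpace ℝ (Fin 3)) : ⟪r, perpPart n v⟫ = ⟪r, v⟫ := by
  simp [perpPart, inner_sub_right, inner_smul_right, hr]

theorem norm_sq_perpPart {n : EuclideanSpace ℝ (Fin 3)} (hn : ‖n‖ = 1)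
    (v : EuclideanSpace ℝ (Fin 3)) : ‖perpPart n v‖ ^ 2 = ‖v‖ ^ 2 - ⟪n, v⟫ ^ 2 := by
  rw [perpPart, norm_sub_sq_real, norm_smul, inner_smul_right, hn, real_inner_comm, Real.norm_eq_abs,
    mul_one, sq_abs]
  ring

theorem norm_perpPart_le {n : EuclideanSpace ℝ (Fin 3)} (hn : ‖n‖ = 1)
    (v : EuclideanSpace ℝ (Fin 3)) : ‖perpPart n v‖ ≤ ‖v‖ := by
  have := norm_sq_perpPart hn v
  nlinarith [norm_nonneg v, norm_nonneg (perpPart n v), sq_nonneg (⟪n, v⟫ : ℝ)]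

theorem trace_state_mul_unbiasedEffect (r b : EuclideanSpace ℝ (Fin 3)) (x : Bool) :
    (((1 / 2 : ℂ) • (1 + dotPauli r)) * unbiasedEffect b x).trace =
      (1 + (if x then 1 else -1) * (⟪r, b⟫ : ℝ)) / 2 := by
  cases x <;>
    simp [unbiasedEffect, mul_add, add_mul, mul_sub, Matrix.trace_add, Matrix.trace_sub,
      trace_dotPauli, trace_dotPauli_mul_dotPauli] <;> ring

/-- The disc orthogonal to `n` sees only the projections of the Bloch vectors, so compatibility on it
is Busch's criterion for the projected pair. -/
theorem compatibleOn_equatorialDisc_iff {n : EuclideanSpace ℝ (Fin 3)} (hn : ‖n‖ = 1)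
    {b₁ b₂ : EuclideanSpace ℝ (Fin 3)} (h₁ : ‖b₁‖ ≤ 1) (h₂ : ‖b₂‖ ≤ 1) :
    CompatibleOn (equatorialDisc n) (unbiasedPair b₁ b₂ h₁ h₂) ↔
      ‖perpPart n (b₁ + b₂)‖ + ‖perpPart n (b₁ - b₂)‖ ≤ 2 := by
  constructor
  · rintro ⟨A', ⟨J, hJ⟩, hA'⟩
    set E : Bool → Bool → Matrix (Fin 2) (Fin 2) ℂ := fun x y => J.effect ![x, y] with hE
    have m0 : (A' 0).effect true = E true true + E true false := by
      rw [hJ, Finset.sum_filter, sum_finTwoArrow]; simp [hE]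
    have m1 : (A' 1).effect true = E true true + E false true := by
      rw [hJ, Finset.sum_filter, sum_finTwoArrow]; simp [hE]
    have tot : E true true + E true false + E false true + E false false = 1 := by
      rw [← J.sum_eq_one, sum_finTwoArrow]
    -- `Tr[(r·σ) X]` is recovered from the states with Bloch vectors `r` and `0`, so the spin
    -- components in the plane of the disc are those of the given pair
    have small : ∀ r : EuclideanSpace ℝ (Fin 3), ‖r‖ ≤ 1 → ⟪r, n⟫ = 0 →
        ∀ i, (dotPauli r * (A' i).effect true).trace = (⟪r, ![b₁, b₂] i⟫ : ℝ) := by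
      intro r hr hrn i
      have k1 := hA' i true _ ⟨r, hr, hrn, rfl⟩
      have k2 := hA' i true _ ⟨0, by simp, by simp, rfl⟩
      have hu : (unbiasedPair b₁ b₂ h₁ h₂ i).effect = unbiasedEffect (![b₁, b₂] i) := by
        fin_cases i <;> rfl
      rw [hu, trace_state_mul_unbiasedEffect] at k1 k2
      simp [add_mul, Matrix.trace_add, dotPauli_zero] at k1 k2
      linear_combination 2 * k1 - k2
    have big : ∀ r : EuclideanSpace ℝ (Fin 3), ⟪r, n⟫ = 0 →
        ∀ i, (dotPauli r * (A' i).effect true).trace = (⟪r, ![b₁, b₂] i⟫ : ℝ) := by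
      intro r hrn i
      rcases eq_or_ne r 0 with rfl | hr
      · simp [dotPauli_zero]
      have hr0 : (‖r‖ : ℂ) ≠ 0 := by exact_mod_cast (norm_ne_zero_iff.mpr hr)
      have := small (‖r‖⁻¹ • r) (by simp [norm_smul, hr])
        (by rw [real_inner_smul_left, hrn, mul_zero]) i
      rw [dotPauli_smul, real_inner_smul_left] at this
      simpa [hr0] using this
    have pos : ∀ x y, 0 ≤ (E x y).trace.re := fun x y =>
      (Complex.le_def.mp (J.posSemidef ![x, y]).trace_nonneg).1
    have ttot : (E true true).trace.re + (E true false).trace.re + (E false true).trace.re +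
        (E false false).trace.re = 2 := by
      rw [← Complex.add_re, ← Complex.add_re, ← Complex.add_re, ← Matrix.trace_add,
        ← Matrix.trace_add, ← Matrix.trace_add, tot]
      simp
    -- test `E(xy) - E(x'y')` against the spin component along the projection of `v`
    have bound : ∀ (v : EuclideanSpace ℝ (Fin 3)) (x y x' y' : Bool),
        (∀ r : EuclideanSpace ℝ (Fin 3), ⟪r, n⟫ = 0 →
          ((⟪r, v⟫ : ℝ) : ℂ) = (dotPauli r * (E x y - E x' y')).trace) →
        ‖perpPart n v‖ ≤ (E x y).trace.re + (E x' y').trace.re := by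
      intro v x y x' y' hv
      have ho := inner_perpPart_self hn v
      have k := hv _ ho
      rw [← inner_perpPart_of_orthogonal ho, real_inner_self_eq_norm_sq, mul_sub,
        Matrix.trace_sub] at k
      have k' := congrArg Complex.re k
      rw [Complex.ofReal_re, Complex.sub_re] at k'
      have l1 := trace_dotPauli_mul_le (J.posSemidef ![x, y]) (perpPart n v)
      have l2 := trace_dotPauli_mul_le (J.posSemidef ![x', y']) (-perpPart n v)
      rw [dotPauli_neg, neg_mul, Matrix.trace_neg, Complex.neg_re, norm_neg] at l2
      change _ ≤ _ * (E x y).trace.re at l1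
      change _ ≤ _ * (E x' y').trace.re at l2
      rcases (norm_nonneg (perpPart n v)).eq_or_lt with h0 | h0
      · rw [← h0]; exact add_nonneg (pos _ _) (pos _ _)
      · refine le_of_mul_le_mul_left ?_ h0
        simp only [E] at k' l1 l2 ⊢
        nlinarith
    have c1 := bound (b₁ + b₂) true true false false (by
      intro r hr
      have e0 := big r hr 0
      have e1 := big r hr 1
      simp only [Matrix.cons_val_zero, Matrix.cons_val_one] at e0 e1
      have : E true true - E false false = (A' 0).effect true + (A' 1).effect true - 1 := by
        rw [m0, m1, ← tot]; abel
      rw [this, mul_sub, mul_add, Matrix.trace_sub, Matrix.trace_add, e0, e1, mul_one,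
        trace_dotPauli, inner_add_right]
      simp)
    have c2 := bound (b₁ - b₂) true false false true (by
      intro r hr
      have e0 := big r hr 0
      have e1 := big r hr 1
      simp only [Matrix.cons_val_zero, Matrix.cons_val_one] at e0 e1
      have : E true false - E false true = (A' 0).effect true - (A' 1).effect true := by
        rw [m0, m1]; abel
      rw [this, mul_sub, Matrix.trace_sub, e0, e1, inner_sub_right]
      simp)
    linarith
  · intro h
    rw [perpPart_add, perpPart_sub] at h
    refine ⟨_, compatible_unbiasedPair ((norm_perpPart_le hn _).trans h₁)
      ((norm_perpPart_le hn _).trans h₂) h, ?_⟩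
    rintro i x ρ ⟨r, hr, hrn, rfl⟩
    fin_cases i <;>
      simp only [unbiasedPair, unbiasedObs, Fin.zero_eta, Fin.mk_one, Matrix.cons_val_zero,
        Matrix.cons_val_one, trace_state_mul_unbiasedEffect, inner_perpPart_of_orthogonal hrn]

/-! ### Relabelling outcomes and observables -/

section Relabel

variable {d ι X : Type*} [Fintype d] [DecidableEq d] [Fintype ι] [DecidableEq ι] [Fintype X]
  [DecidableEq X]

/-- Outcome `x` of `B i` is outcome `τ i x` of `A (σ i)`, so a joint observable of `A` is turned into
one of `B` by the bijection of outcome tuples that sends `f` to the tuple with value `τ i (f i)` at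
`σ i`. -/
theorem Compatible.relabel {A B : ι → Observable d X} (σ : Equiv.Perm ι) (τ : ι → Equiv.Perm X)
    (hB : ∀ i x, (B i).effect x = (A (σ i)).effect (τ i x)) (hA : Compatible A) :
    Compatible B := by
  obtain ⟨J, hJ⟩ := hA
  let e : (ι → X) ≃ (ι → X) := (Equiv.piCongrRight τ).trans (σ.arrowCongr (Equiv.refl X))
  have he : ∀ f i, e f (σ i) = τ i (f i) := by
    intro f i
    simp [e, Equiv.arrowCongr]
  refine ⟨⟨fun f => J.effect (e f), fun f => J.posSemidef _, ?_⟩, ?_⟩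
  · rw [e.sum_comp J.effect, J.sum_eq_one]
  · intro i x
    rw [hB, hJ, eq_comm]
    refine Finset.sum_equiv e ?_ (fun _ _ => rfl)
    intro f
    simp [he]

theorem CompatibleOn.relabel {S₀ : Set (Matrix d d ℂ)} {A B : ι → Observable d X}
    (σ : Equiv.Perm ι) (τ : ι → Equiv.Perm X)
    (hB : ∀ i x, (B i).effect x = (A (σ i)).effect (τ i x)) (hA : CompatibleOn S₀ A) :
    CompatibleOn S₀ B := by
  obtain ⟨A', hA', hS⟩ := hA
  refine ⟨fun i => ⟨fun x => (A' (σ i)).effect (τ i x), fun x => (A' (σ i)).posSemidef _, ?_⟩,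
    hA'.relabel σ τ (fun _ _ => rfl), fun i x ρ hρ => ?_⟩
  · rw [Equiv.sum_comp (τ i) (A' (σ i)).effect, (A' (σ i)).sum_eq_one]
  · rw [hB]
    exact hS _ _ ρ hρ

theorem EquivInc.of_relabel {A B : ι → Observable d X} (σ : Equiv.Perm ι) (τ : ι → Equiv.Perm X)
    (hB : ∀ i x, (B i).effect x = (A (σ i)).effect (τ i x)) : EquivInc A B := by
  refine ⟨fun S _ h hB' => h (hB'.relabel σ⁻¹ (fun i => (τ (σ⁻¹ i))⁻¹) fun i x => ?_),
    fun S _ h hA => h (hA.relabel σ τ hB)⟩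
  simp [hB]

end Relabel

theorem unbiasedEffect_neg (a : EuclideanSpace ℝ (Fin 3)) (x : Bool) :
    unbiasedEffect (-a) x = unbiasedEffect a (!x) := by
  cases x <;> simp [unbiasedEffect, dotPauli_neg, sub_eq_add_neg]

theorem exists_relabel_of_eq_or_eq_neg {a b : EuclideanSpace ℝ (Fin 3)} (h : b = a ∨ b = -a) :
    ∃ τ : Equiv.Perm Bool, ∀ x, unbiasedEffect b x = unbiasedEffect a (τ x) := by
  rcases h with rfl | rfl
  · exact ⟨1, fun x => rfl⟩
  · exact ⟨Equiv.boolNot, fun x => unbiasedEffect_neg a x⟩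

theorem equivInc_unbiasedPair {a₁ a₂ b₁ b₂ : EuclideanSpace ℝ (Fin 3)} (ha₁ : ‖a₁‖ ≤ 1)
    (ha₂ : ‖a₂‖ ≤ 1) (hb₁ : ‖b₁‖ ≤ 1) (hb₂ : ‖b₂‖ ≤ 1)
    (h : ((b₁ = a₁ ∨ b₁ = -a₁) ∧ (b₂ = a₂ ∨ b₂ = -a₂)) ∨
      ((b₁ = a₂ ∨ b₁ = -a₂) ∧ (b₂ = a₁ ∨ b₂ = -a₁))) :
    EquivInc (unbiasedPair a₁ a₂ ha₁ ha₂) (unbiasedPair b₁ b₂ hb₁ hb₂) := by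
  rcases h with ⟨h1, h2⟩ | ⟨h1, h2⟩ <;>
    obtain ⟨τ₁, hτ₁⟩ := exists_relabel_of_eq_or_eq_neg h1 <;>
    obtain ⟨τ₂, hτ₂⟩ := exists_relabel_of_eq_or_eq_neg h2
  · refine EquivInc.of_relabel 1 ![τ₁, τ₂] fun i x => ?_
    fin_cases i
    · exact hτ₁ x
    · exact hτ₂ x
  · refine EquivInc.of_relabel (Equiv.swap 0 1) ![τ₁, τ₂] fun i x => ?_
    fin_cases i
    · exact hτ₁ x
    · exact hτ₂ x

/-! ### Polynomial relations along the boundary curve -/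

/-- A real quartic that vanishes on `(0, ε)` is zero; five equally spaced roots suffice. -/
theorem quartic_coeffs_eq_zero {ε a₀ a₁ a₂ a₃ a₄ : ℝ} (hε : 0 < ε)
    (h : ∀ x, 0 < x → x < ε → a₀ + a₁ * x + a₂ * x ^ 2 + a₃ * x ^ 3 + a₄ * x ^ 4 = 0) :
    a₀ = 0 ∧ a₁ = 0 ∧ a₂ = 0 ∧ a₃ = 0 ∧ a₄ = 0 := by
  obtain ⟨η, hη, hε'⟩ : ∃ η : ℝ, 0 < η ∧ 6 * η = ε := ⟨ε / 6, by positivity, by ring⟩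
  have h1 := h η hη (by linarith)
  have h2 := h (2 * η) (by linarith) (by linarith)
  have h3 := h (3 * η) (by linarith) (by linarith)
  have h4 := h (4 * η) (by linarith) (by linarith)
  have h5 := h (5 * η) (by linarith) (by linarith)
  ring_nf at h1 h2 h3 h4 h5
  have n := hη.ne'
  refine ⟨by linarith, ?_, ?_, ?_, ?_⟩
  · exact (mul_eq_zero.mp (show a₁ * η = 0 by linarith)).resolve_right n
  · exact (mul_eq_zero.mp (show a₂ * η ^ 2 = 0 by linarith)).resolve_right (pow_ne_zero _ n)
  · exact (mul_eq_zero.mp (show a₃ * η ^ 3 = 0 by linarith)).resolve_right (pow_ne_zero _ n)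
  · exact (mul_eq_zero.mp (show a₄ * η ^ 4 = 0 by linarith)).resolve_right (pow_ne_zero _ n)

theorem sq_sub_of_sqrt_add_sqrt_eq_two {X Y : ℝ} (hX : 0 ≤ X) (hY : 0 ≤ Y)
    (h : √X + √Y = 2) : (X - Y) ^ 2 - 8 * (X + Y) + 16 = 0 := by
  obtain ⟨x, hx, rfl⟩ : ∃ x : ℝ, 0 ≤ x ∧ X = x ^ 2 := ⟨√X, by positivity, (Real.sq_sqrt hX).symm⟩
  obtain ⟨y, hy, rfl⟩ : ∃ y : ℝ, 0 ≤ y ∧ Y = y ^ 2 := ⟨√Y, by positivity, (Real.sq_sqrt hY).symm⟩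
  rw [Real.sqrt_sq hx, Real.sqrt_sq hy] at h
  obtain rfl : y = 2 - x := by linarith
  ring

/-- The length of the projection of `c` onto the plane orthogonal to `(U, V, W)`, for a unit vector
`(U, V, W)`. -/
noncomputable def projLength (c : Fin 3 → ℝ) (U V W : ℝ) : ℝ :=
  √(c 0 ^ 2 + c 1 ^ 2 + c 2 ^ 2 - (c 0 * U + c 1 * V + c 2 * W) ^ 2)

theorem projLength_radicand_nonneg (c : Fin 3 → ℝ) {U V W : ℝ} (h : U ^ 2 + V ^ 2 + W ^ 2 = 1) :
    0 ≤ c 0 ^ 2 + c 1 ^ 2 + c 2 ^ 2 - (c 0 * U + c 1 * V + c 2 * W) ^ 2 := by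
  have : c 0 ^ 2 + c 1 ^ 2 + c 2 ^ 2 - (c 0 * U + c 1 * V + c 2 * W) ^ 2 =
      (c 0 * V - c 1 * U) ^ 2 + (c 0 * W - c 2 * U) ^ 2 + (c 1 * W - c 2 * V) ^ 2 := by
    linear_combination (-(c 0 ^ 2 + c 1 ^ 2 + c 2 ^ 2)) * h
  rw [this]
  positivity

/-- If two pairs are detected by the same equatorial discs, the second one satisfies the compatibility
criterion with equality on the boundary curve of the first. Equality follows by approaching the
boundary point along its meridian from the pole `(0, 0, 1)`, where the discs detect. -/
theorem projLength_add_eq_two_of_boundary {k : ℝ} (c d : Fin 3 → ℝ)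
    (H : ∀ U V W : ℝ, U ^ 2 + V ^ 2 + W ^ 2 = 1 → projLength c U V W + projLength d U V W ≤ 2 →
      √(1 - U ^ 2) + √(1 - V ^ 2) ≤ k)
    (H' : ∀ U V W : ℝ, U ^ 2 + V ^ 2 + W ^ 2 = 1 → √(1 - U ^ 2) + √(1 - V ^ 2) ≤ k →
      projLength c U V W + projLength d U V W ≤ 2)
    {U V W : ℝ} (hn : U ^ 2 + V ^ 2 + W ^ 2 = 1) (hU : U ≠ 0) (hW : 0 < W)
    (hk : √(1 - U ^ 2) + √(1 - V ^ 2) = k) :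
    projLength c U V W + projLength d U V W = 2 := by
  refine le_antisymm (H' U V W hn hk.le) ?_
  -- the meridian through `(U, V, W)` is `l ↦ (l U, l V, w l)`, with the pole at `l = 0`
  let w : ℝ → ℝ := fun l => √(1 - (l * U) ^ 2 - (l * V) ^ 2)
  have hw1 : w 1 = W := by
    simp only [w, one_mul]
    rw [show 1 - U ^ 2 - V ^ 2 = W ^ 2 by linarith, Real.sqrt_sq hW.le]
  have hcont : Continuous fun l => projLength c (l * U) (l * V) (w l) +
      projLength d (l * U) (l * V) (w l) := by
    unfold projLength
    fun_prop
  have ht := (hcont.tendsto 1).mono_left (nhdsWithin_le_nhds (s := Set.Iio 1))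
  simp only [hw1, one_mul] at ht
  refine ge_of_tendsto ht ?_
  filter_upwards [Ioo_mem_nhdsLT (zero_lt_one' ℝ)] with l hl
  have hl2 : l ^ 2 < 1 := by nlinarith [hl.1, hl.2]
  have hU2 : 0 < U ^ 2 := by positivity
  by_contra hlt
  have hunit : (l * U) ^ 2 + (l * V) ^ 2 + w l ^ 2 = 1 := by
    have : 0 ≤ 1 - (l * U) ^ 2 - (l * V) ^ 2 := by nlinarith [sq_nonneg V, sq_nonneg W]
    simp only [w, Real.sq_sqrt this]
    ring
  have := H _ _ _ hunit (not_le.mp hlt).le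
  have h1 : √(1 - U ^ 2) < √(1 - (l * U) ^ 2) :=
    Real.sqrt_lt_sqrt (by nlinarith [sq_nonneg V, sq_nonneg W]) (by nlinarith)
  have h2 : √(1 - V ^ 2) ≤ √(1 - (l * V) ^ 2) :=
    Real.sqrt_le_sqrt (by nlinarith [sq_nonneg V])
  linarith

/-- A quartic that vanishes at all reflections of `(U, V, W)` has vanishing even part, and vanishing
cofactors of `UV`, `UW` and `VW`. Here `e` and `f` stand for the symmetric matrices `c cᵀ - d dᵀ` and
`c cᵀ + d dᵀ`. -/
theorem separate_signs (e11 e22 e33 e12 e13 e23 f11 f22 f33 f12 f13 f23 : ℝ) {U V W : ℝ}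
    (hU : U ≠ 0) (hV : V ≠ 0) (hW : W ≠ 0)
    (G : ∀ U' V', (U' = U ∨ U' = -U) → (V' = V ∨ V' = -V) →
      ((e11+e22+e33) - (e11*U'^2+e22*V'^2+e33*W^2)
        - 2*(e12*(U'*V')+e13*(U'*W)+e23*(V'*W)))^2
        - 8 * ((f11+f22+f33) - (f11*U'^2+f22*V'^2+f33*W^2)
          - 2*(f12*(U'*V')+f13*(U'*W)+f23*(V'*W))) + 16 = 0) :
    ((e11+e22+e33) - (e11*U^2+e22*V^2+e33*W^2))^2
        + 4*(e12^2*(U^2*V^2)+e13^2*(U^2*W^2)+e23^2*(V^2*W^2))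
        - 8*((f11+f22+f33) - (f11*U^2+f22*V^2+f33*W^2)) + 16 = 0 ∧
      2*e13*e23*W^2 - ((e11+e22+e33) - (e11*U^2+e22*V^2+e33*W^2))*e12 + 4*f12 = 0 ∧
      2*e12*e23*V^2 - ((e11+e22+e33) - (e11*U^2+e22*V^2+e33*W^2))*e13 + 4*f13 = 0 ∧
      2*e12*e13*U^2 - ((e11+e22+e33) - (e11*U^2+e22*V^2+e33*W^2))*e23 + 4*f23 = 0 := by
  have g1 := G U V (.inl rfl) (.inl rfl)
  have g2 := G (-U) V (.inr rfl) (.inl rfl)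
  have g3 := G U (-V) (.inl rfl) (.inr rfl)
  have g4 := G (-U) (-V) (.inr rfl) (.inr rfl)
  refine ⟨by linear_combination (g1 + g2 + g3 + g4) / 4, ?_, ?_, ?_⟩
  · refine (mul_eq_zero.mp ?_).resolve_left (mul_ne_zero hU hV)
    linear_combination (g1 - g2 - g3 + g4) / 16
  · refine (mul_eq_zero.mp ?_).resolve_left (mul_ne_zero hU hW)
    linear_combination (g1 - g2 + g3 - g4) / 16
  · refine (mul_eq_zero.mp ?_).resolve_left (mul_ne_zero hV hW)
    linear_combination (g1 + g2 - g3 - g4) / 16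

/-- The functions `1 - (k/2+h)²`, `1 - (k/2-h)²` and `1` of `h` are linearly independent. -/
theorem affine_relation {k ε : ℝ} (hk : k ≠ 0) (hε : 0 < ε) {A B C : ℝ}
    (hABC : ∀ h, 0 < h → h < ε → A * (1 - (k/2+h)^2) + B * (1 - (k/2-h)^2) + C = 0) :
    A = 0 ∧ B = 0 ∧ C = 0 := by
  obtain ⟨z0, z1, z2, -, -⟩ := quartic_coeffs_eq_zero (a₀ := (A+B) * (1 - k^2/4) + C)
    (a₁ := -(A - B) * k) (a₂ := -(A + B)) (a₃ := 0) (a₄ := 0) hε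
    (fun h h0 h1 => by linear_combination hABC h h0 h1)
  have : A - B = 0 := (mul_eq_zero.mp (show (A - B) * k = 0 by linarith)).resolve_right hk
  obtain ⟨rfl, rfl⟩ : A = 0 ∧ B = 0 := ⟨by linarith, by linarith⟩
  exact ⟨rfl, rfl, by linarith⟩

/-- With `p = 1 - (k/2+h)²` and `q = 1 - (k/2-h)²`, the quadratic relations between `p` and `q` are
the multiples of `(p - q)² + 2 k² (p + q) - 4 k² (1 - k²/4) = 0`. -/
theorem quadratic_relation {k ε : ℝ} (hk : k ≠ 0) (hε : 0 < ε) {a b c d e f : ℝ}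
    (hh : ∀ h, 0 < h → h < ε → ∀ p q, p = 1 - (k/2+h)^2 →
      q = 1 - (k/2-h)^2 → a*p^2 + b*(p*q) + c*q^2 + d*p + e*q + f = 0) :
    c = a ∧ b = -2*a ∧ d = 2*a*k^2 ∧ e = 2*a*k^2 ∧ f = -4*a*k^2*(1-k^2/4) := by
  obtain ⟨z0, z1, z2, z3, z4⟩ := quartic_coeffs_eq_zero
    (a₀ := (a+b+c)*(1-k^2/4)^2 + (d+e)*(1-k^2/4) + f)
    (a₁ := (-2*a+2*c)*(1-k^2/4)*k + (e-d)*k)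
    (a₂ := (a-b+c)*k^2 - 2*(a+b+c)*(1-k^2/4) - (d+e))
    (a₃ := 2*(a-c)*k) (a₄ := a+b+c) hε
    (fun h h0 h1 => by
      rw [← hh h h0 h1 _ _ rfl rfl]
      ring)
  have i1 : a - c = 0 := (mul_eq_zero.mp (show (a - c) * k = 0 by linarith)).resolve_right hk
  obtain rfl : c = a := by linarith
  obtain rfl : b = -2 * c := by linarith
  have i2 : e - d = 0 := (mul_eq_zero.mp (show (e - d) * k = 0 by linarith)).resolve_right hk
  obtain rfl : e = d := by linarith
  have i3 : e = 2*c*k^2 := by linear_combination (-1/2)*z2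
  refine ⟨rfl, rfl, i3, i3, ?_⟩
  linear_combination z0 - 2*(1-k^2/4)*i3

/-- The equation `|P c| + |P d| = 2` without radicals, in the entries of `c cᵀ ∓ d dᵀ`. -/
theorem projLength_eq_two_expand (c d : Fin 3 → ℝ) {U V W : ℝ} (h : U ^ 2 + V ^ 2 + W ^ 2 = 1)
    (hF : projLength c U V W + projLength d U V W = 2) :
    (((c 0*c 0-d 0*d 0)+(c 1*c 1-d 1*d 1)+(c 2*c 2-d 2*d 2))
      - ((c 0*c 0-d 0*d 0)*U^2+(c 1*c 1-d 1*d 1)*V^2+(c 2*c 2-d 2*d 2)*W^2)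
      - 2*((c 0*c 1-d 0*d 1)*(U*V)+(c 0*c 2-d 0*d 2)*(U*W)+(c 1*c 2-d 1*d 2)*(V*W)))^2
    - 8 * (((c 0*c 0+d 0*d 0)+(c 1*c 1+d 1*d 1)+(c 2*c 2+d 2*d 2))
      - ((c 0*c 0+d 0*d 0)*U^2+(c 1*c 1+d 1*d 1)*V^2+(c 2*c 2+d 2*d 2)*W^2)
      - 2*((c 0*c 1+d 0*d 1)*(U*V)+(c 0*c 2+d 0*d 2)*(U*W)+(c 1*c 2+d 1*d 2)*(V*W))) + 16 = 0 := by
  rw [← sq_sub_of_sqrt_add_sqrt_eq_two (projLength_radicand_nonneg c h)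
      (projLength_radicand_nonneg d h) hF]
  ring

/-- The matrices `e = c cᵀ - d dᵀ` and `f = c cᵀ + d dᵀ` of the quartic are diagonal, and their
diagonal entries satisfy the relations obtained by comparing coefficients on the curve. Only the
equations, not the form of `e` and `f`, are used. -/
theorem coefficient_relations (e11 e22 e33 e12 e13 e23 f11 f22 f33 f12 f13 f23 : ℝ) {k ε : ℝ}
    (hk : k ≠ 0) (hε : 0 < ε)
    (S : ∀ h, 0 < h → h < ε → ∀ p q r, p = 1 - (k/2+h)^2 → q = 1 - (k/2-h)^2 → r = 1 - p - q →
      ((e11+e22+e33) - (e11*p+e22*q+e33*r))^2 + 4*(e12^2*(p*q)+e13^2*(p*r)+e23^2*(q*r))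
        - 8*((f11+f22+f33) - (f11*p+f22*q+f33*r)) + 16 = 0 ∧
      2*e13*e23*r - ((e11+e22+e33) - (e11*p+e22*q+e33*r))*e12 + 4*f12 = 0 ∧
      2*e12*e23*q - ((e11+e22+e33) - (e11*p+e22*q+e33*r))*e13 + 4*f13 = 0 ∧
      2*e12*e13*p - ((e11+e22+e33) - (e11*p+e22*q+e33*r))*e23 + 4*f23 = 0) :
    (e12 = 0 ∧ e13 = 0 ∧ e23 = 0 ∧ f12 = 0 ∧ f13 = 0 ∧ f23 = 0) ∧ 2 * e33 = e11 + e22 ∧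
      2*e33*(e33-e11) + 4*(f11-f33) = (e33-e11)^2*k^2 ∧
      2*e33*(e33-e22) + 4*(f22-f33) = (e33-e11)^2*k^2 ∧
      e33^2 + 4 - 2*(f11+f22) = -(e33-e11)^2*k^2*(1-k^2/4) := by
  obtain ⟨u1, u2, u3⟩ := affine_relation (A := -2*e13*e23 - (e33-e11)*e12)
    (B := -2*e13*e23 - (e33-e22)*e12) (C := 2*e13*e23 - (e11+e22)*e12 + 4*f12) hk hε
    (fun h h0 h1 => by linear_combination (S h h0 h1 _ _ _ rfl rfl rfl).2.1)
  obtain ⟨v1, v2, v3⟩ := affine_relation (A := -(e33-e11)*e13)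
    (B := 2*e12*e23 - (e33-e22)*e13) (C := -(e11+e22)*e13 + 4*f13) hk hε
    (fun h h0 h1 => by linear_combination (S h h0 h1 _ _ _ rfl rfl rfl).2.2.1)
  obtain ⟨w1, w2, w3⟩ := affine_relation (A := 2*e12*e13 - (e33-e11)*e23)
    (B := -(e33-e22)*e23) (C := -(e11+e22)*e23 + 4*f23) hk hε
    (fun h h0 h1 => by linear_combination (S h h0 h1 _ _ _ rfl rfl rfl).2.2.2)
  obtain ⟨q1, q2, q3, q4, q5⟩ := quadratic_relation (a := (e33-e11)^2 - 4*e13^2)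
    (b := 2*(e33-e11)*(e33-e22) + 4*e12^2-4*e13^2-4*e23^2)
    (c := (e33-e22)^2 - 4*e23^2) (d := 2*(e11+e22)*(e33-e11)+4*e13^2+8*(f11-f33))
    (e := 2*(e11+e22)*(e33-e22)+4*e23^2+8*(f22-f33)) (f := (e11+e22)^2+16-8*(f11+f22)) hk hε
    (fun h h0 h1 p q hp hq => by
      rw [← (S h h0 h1 p q _ hp hq rfl).1]
      ring)
  clear S
  have z13 : e13 = 0 := by
    by_contra hne
    have t1 : e33 - e11 = 0 := neg_eq_zero.mp ((mul_eq_zero.mp v1).resolve_right hne)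
    have hp : 0 < e13^2 := by positivity
    rw [t1] at q1 q2
    have hne2 : e23 ≠ 0 := by
      rintro rfl
      nlinarith [sq_nonneg (e33-e22)]
    have t2 : e33 - e22 = 0 := neg_eq_zero.mp ((mul_eq_zero.mp w2).resolve_right hne2)
    rw [t2] at q1 q2 v2
    have t3 : e12 = 0 := by simpa [hne2] using v2
    rw [t3] at q2
    linarith
  subst z13
  have z23 : e23 = 0 := by
    by_contra hne
    have t2 : e33 - e22 = 0 := neg_eq_zero.mp ((mul_eq_zero.mp w2).resolve_right hne)
    rw [t2] at q1
    have : 0 < e23^2 := by positivity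
    linarith [sq_nonneg (e33-e11)]
  subst z23
  have z12 : e12 = 0 := by
    by_contra hne
    have t1 : e33 - e11 = 0 := by simpa [hne] using u1
    rw [t1] at q2
    have : 0 < e12^2 := by positivity
    linarith
  subst z12
  have z33 : 2 * e33 = e11 + e22 := by
    have : (2 * e33 - (e11 + e22)) ^ 2 = 0 := by linear_combination q1 + q2
    linarith [(pow_eq_zero_iff two_ne_zero).mp this]
  refine ⟨⟨rfl, rfl, rfl, by linarith, by linarith, by linarith⟩, z33, ?_, ?_, ?_⟩
  · linear_combination q3 / 2 + (e33 - e11) * z33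
  · linear_combination q4 / 2 + (e33 - e22) * z33
  · linear_combination q5 / 4 + (2 * e33 + e11 + e22) / 4 * z33

/-- The hypotheses say that `c` and `d` lie along coordinate axes and satisfy the relations of
`coefficient_relations`. Together these exclude the third axis, a common axis and a zero vector, and
fix the lengths. -/
theorem axes_of_diagonal (c d : Fin 3 → ℝ) {k : ℝ} (hk : k ≠ 0)
    (k01 : c 0 * c 1 = 0) (k02 : c 0 * c 2 = 0) (k12 : c 1 * c 2 = 0)
    (l01 : d 0 * d 1 = 0) (l02 : d 0 * d 2 = 0) (l12 : d 1 * d 2 = 0)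
    (h33 : 2 * (c 2 * c 2 - d 2 * d 2) = (c 0 * c 0 - d 0 * d 0) + (c 1 * c 1 - d 1 * d 1))
    (h1 : 2*(c 2*c 2-d 2*d 2)*((c 2*c 2-d 2*d 2)-(c 0*c 0-d 0*d 0))
      + 4*((c 0*c 0+d 0*d 0)-(c 2*c 2+d 2*d 2)) = ((c 2*c 2-d 2*d 2)-(c 0*c 0-d 0*d 0))^2*k^2)
    (h2 : 2*(c 2*c 2-d 2*d 2)*((c 2*c 2-d 2*d 2)-(c 1*c 1-d 1*d 1))
      + 4*((c 1*c 1+d 1*d 1)-(c 2*c 2+d 2*d 2)) = ((c 2*c 2-d 2*d 2)-(c 0*c 0-d 0*d 0))^2*k^2)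
    (h3 : (c 2*c 2-d 2*d 2)^2 + 4 - 2*((c 0*c 0+d 0*d 0)+(c 1*c 1+d 1*d 1)) =
      -((c 2*c 2-d 2*d 2)-(c 0*c 0-d 0*d 0))^2*k^2*(1-k^2/4)) :
    (c 1 = 0 ∧ c 2 = 0 ∧ d 0 = 0 ∧ d 2 = 0 ∧ c 0 ^ 2 = 4 / k ^ 2 ∧ d 1 ^ 2 = 4 / k ^ 2) ∨
    (c 0 = 0 ∧ c 2 = 0 ∧ d 1 = 0 ∧ d 2 = 0 ∧ c 1 ^ 2 = 4 / k ^ 2 ∧ d 0 ^ 2 = 4 / k ^ 2) := by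
  have solve : ∀ x : ℝ, x ≠ 0 → 4 * x ^ 2 = x ^ 4 * k ^ 2 → x ^ 2 = 4 / k ^ 2 := by
    intro x hx h
    rw [eq_div_iff (pow_ne_zero _ hk)]
    refine mul_left_cancel₀ (pow_ne_zero 2 hx) ?_
    linear_combination -h
  have hc2 : c 2 = 0 := by
    by_contra hne
    have a0 : c 0 = 0 := by simpa [hne] using k02
    have a1 : c 1 = 0 := by simpa [hne] using k12
    have hp : 0 < c 2 * c 2 := mul_self_pos.mpr hne
    rw [a0, a1] at h33
    rw [a0] at h1
    by_cases hd : d 2 = 0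
    · rw [hd] at h33
      nlinarith [mul_self_nonneg (d 0), mul_self_nonneg (d 1)]
    · have b0 : d 0 = 0 := by simpa [hd] using l02
      have b1 : d 1 = 0 := by simpa [hd] using l12
      rw [b0, b1] at h33
      rw [b0, show c 2 * c 2 - d 2 * d 2 = 0 by linarith] at h1
      nlinarith [mul_self_nonneg (d 2)]
  have hd2 : d 2 = 0 := by
    by_contra hne
    have b0 : d 0 = 0 := by simpa [hne] using l02
    have b1 : d 1 = 0 := by simpa [hne] using l12
    have hp : 0 < d 2 * d 2 := mul_self_pos.mpr hne
    rw [b0, b1, hc2] at h33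
    nlinarith [mul_self_nonneg (c 0), mul_self_nonneg (c 1)]
  rw [hc2, hd2] at h33 h1 h2 h3
  by_cases hc0 : c 0 = 0
  · right
    rw [hc0] at h33 h1 h2 h3
    have hd0 : d 0 ≠ 0 := by
      intro hd0
      rw [hd0] at h33 h1 h2 h3
      linarith
    have hd1 : d 1 = 0 := by simpa [hd0] using l01
    rw [hd1] at h33
    have hd : d 0 ^ 2 = 4 / k ^ 2 := solve _ hd0 (by linear_combination h1)
    exact ⟨hc0, hc2, hd1, hd2, by rw [← hd]; linear_combination -h33, hd⟩
  · left
    have hc1 : c 1 = 0 := by simpa [hc0] using k01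
    have hd0 : d 0 = 0 := by
      by_contra hd0
      have hd1 : d 1 = 0 := by simpa [hd0] using l01
      have hp : 0 < c 0 * c 0 := mul_self_pos.mpr hc0
      rw [hc1, hd1] at h33
      rw [show c 0 * c 0 - d 0 * d 0 = 0 by linarith] at h1
      nlinarith [mul_self_nonneg (d 0)]
    rw [hc1, hd0] at h33
    rw [hd0] at h1
    have hc : c 0 ^ 2 = 4 / k ^ 2 := solve _ hc0 (by linear_combination h1)
    exact ⟨hc1, hc2, hd0, hd2, hc, by rw [← hc]; linear_combination h33⟩

/-- The boundary curve determines `c` and `d` up to signs and exchange of the first two axes. -/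
theorem axes_of_projLength_eq_two {k : ℝ} (hk2 : 2 ≤ k ^ 2) (hk0 : 0 < k) (hk : k < 2)
    (c d : Fin 3 → ℝ)
    (H : ∀ U V W : ℝ, U ^ 2 + V ^ 2 + W ^ 2 = 1 → U ≠ 0 → 0 < W →
      √(1 - U ^ 2) + √(1 - V ^ 2) = k → projLength c U V W + projLength d U V W = 2) :
    (c 1 = 0 ∧ c 2 = 0 ∧ d 0 = 0 ∧ d 2 = 0 ∧ c 0 ^ 2 = 4 / k ^ 2 ∧ d 1 ^ 2 = 4 / k ^ 2) ∨
    (c 0 = 0 ∧ c 2 = 0 ∧ d 1 = 0 ∧ d 2 = 0 ∧ c 1 ^ 2 = 4 / k ^ 2 ∧ d 0 ^ 2 = 4 / k ^ 2) := by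
  have hk1 : 1 < k := by nlinarith
  obtain ⟨⟨e01, e02, e12, f01, f02, f12⟩, h33, h1, h2, h3⟩ := coefficient_relations
    (c 0*c 0-d 0*d 0) (c 1*c 1-d 1*d 1) (c 2*c 2-d 2*d 2)
    (c 0*c 1-d 0*d 1) (c 0*c 2-d 0*d 2) (c 1*c 2-d 1*d 2)
    (c 0*c 0+d 0*d 0) (c 1*c 1+d 1*d 1) (c 2*c 2+d 2*d 2)
    (c 0*c 1+d 0*d 1) (c 0*c 2+d 0*d 2) (c 1*c 2+d 1*d 2) (ε := 1 - k / 2) hk0.ne'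
    (by linarith) (by
      -- `h < 1 - k/2` keeps `p` and `q` positive, and `h ≠ 0` does so for `r = k²/2 - 1 + 2h²`
      intro h h0 h1 p q r hp hq hr
      have hp0 : 0 < p := by
        rw [hp, sub_pos, sq_lt_one_iff₀ (by linarith)]
        linarith
      have hq0 : 0 < q := by
        rw [hq, sub_pos, sq_lt_one_iff₀ (by linarith)]
        linarith
      have hr0 : 0 < r := by
        have : 0 < h ^ 2 := by positivity
        rw [hr, hp, hq]
        linarith
      obtain ⟨U, hU, rfl⟩ : ∃ U : ℝ, 0 < U ∧ p = U ^ 2 :=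
        ⟨√p, Real.sqrt_pos.mpr hp0, (Real.sq_sqrt hp0.le).symm⟩
      obtain ⟨V, hV, rfl⟩ : ∃ U : ℝ, 0 < U ∧ q = U ^ 2 :=
        ⟨√q, Real.sqrt_pos.mpr hq0, (Real.sq_sqrt hq0.le).symm⟩
      obtain ⟨W, hW, rfl⟩ : ∃ U : ℝ, 0 < U ∧ r = U ^ 2 :=
        ⟨√r, Real.sqrt_pos.mpr hr0, (Real.sq_sqrt hr0.le).symm⟩
      refine separate_signs _ _ _ _ _ _ _ _ _ _ _ _ hU.ne' hV.ne' hW.ne' ?_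
      intro U' V' hU' hV'
      have sU : U' ^ 2 = U ^ 2 := sq_eq_sq_iff_eq_or_eq_neg.mpr hU'
      have sV : V' ^ 2 = V ^ 2 := sq_eq_sq_iff_eq_or_eq_neg.mpr hV'
      have hs : U' ^ 2 + V' ^ 2 + W ^ 2 = 1 := by linarith
      refine projLength_eq_two_expand c d hs (H _ _ _ hs ?_ hW ?_)
      · rintro rfl
        exact hU.ne' (pow_eq_zero_iff two_ne_zero |>.mp (by rw [← sU]; ring))
      · rw [show 1 - U' ^ 2 = (k/2+h)^2 by linarith, show 1 - V' ^ 2 = (k/2-h)^2 by linarith,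
          Real.sqrt_sq (by linarith), Real.sqrt_sq (by linarith)]
        ring)
  exact axes_of_diagonal c d hk0.ne' (by linarith) (by linarith) (by linarith) (by linarith)
    (by linarith) (by linarith) h33 h1 h2 h3

/-! ### Diagonal coordinates and the mutually unbiased pair -/

/-- Coordinates with respect to the orthonormal basis `(1,1,0)/√2`, `(1,-1,0)/√2`, `(0,0,1)`. -/
noncomputable def diagCoord (v : EuclideanSpace ℝ (Fin 3)) : Fin 3 → ℝ :=
  ![(v 0 + v 1) / √2, (v 0 - v 1) / √2, v 2]

/-- The vector with given coordinates in the basis of `diagCoord`. -/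
noncomputable def ofDiagCoord (U V W : ℝ) : EuclideanSpace ℝ (Fin 3) :=
  !₂[(U + V) / √2, (U - V) / √2, W]

theorem norm_ofDiagCoord {U V W : ℝ} (h : U ^ 2 + V ^ 2 + W ^ 2 = 1) :
    ‖ofDiagCoord U V W‖ = 1 := by
  rw [← pow_eq_one_iff_of_nonneg (norm_nonneg _) two_ne_zero, norm_sq_fin_three, ← h]
  simp [ofDiagCoord, div_pow]
  ring

theorem norm_perpPart_ofDiagCoord {U V W : ℝ} (h : U ^ 2 + V ^ 2 + W ^ 2 = 1)
    (v : EuclideanSpace ℝ (Fin 3)) :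
    ‖perpPart (ofDiagCoord U V W) v‖ = projLength (diagCoord v) U V W := by
  rw [projLength, eq_comm, Real.sqrt_eq_iff_mul_self_eq (projLength_radicand_nonneg _ h)
    (norm_nonneg _), ← sq, norm_sq_perpPart (norm_ofDiagCoord h), norm_sq_fin_three]
  have h2 : √2 ^ 2 = (2 : ℝ) := Real.sq_sqrt (by norm_num)
  simp [ofDiagCoord, diagCoord, PiLp.inner_apply, Fin.sum_univ_three]
  field_simp
  grind

theorem projLength_diagCoord_mub {t : ℝ} (ht : 0 ≤ t) (U V W : ℝ) :
    projLength (diagCoord (t • xHat + t • yHat)) U V W +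
      projLength (diagCoord (t • xHat - t • yHat)) U V W =
      √2 * t * (√(1 - U ^ 2) + √(1 - V ^ 2)) := by
  have h2 : √2 ^ 2 = (2 : ℝ) := Real.sq_sqrt (by norm_num)
  have h3 : (t + t) / √2 = √2 * t := by
    rw [div_eq_iff (by positivity)]
    linear_combination -t * h2
  have key : ∀ x : ℝ, √((√2 * t) ^ 2 - (√2 * t * x) ^ 2) = √2 * t * √(1 - x ^ 2) := by
    intro x
    rw [mul_pow _ x, ← mul_one_sub, Real.sqrt_mul (by positivity), Real.sqrt_sq (by positivity)]
  simp [projLength, diagCoord, xHat, yHat, h3, key, mul_add]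

theorem one_lt_sqrt_two_mul_of_incompatible {t : ℝ} (ht : t ∈ Set.Icc (0 : ℝ) 1)
    (hinc : Incompatible (mubPair t ht)) : 1 < √2 * t := by
  by_contra hlt
  refine hinc (compatible_unbiasedPair _ _ ?_)
  have h2 : √2 ^ 2 = (2 : ℝ) := Real.sq_sqrt (by norm_num)
  have h1 : ‖t • xHat + t • yHat‖ = √2 * t := by
    rw [← sq_eq_sq₀ (norm_nonneg _) (mul_nonneg (Real.sqrt_nonneg _) ht.1), norm_sq_fin_three]
    simp [xHat, yHat, mul_pow]
    ring
  have h1' : ‖t • xHat - t • yHat‖ = √2 * t := by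
    rw [← sq_eq_sq₀ (norm_nonneg _) (mul_nonneg (Real.sqrt_nonneg _) ht.1), norm_sq_fin_three]
    simp [xHat, yHat, mul_pow]
    ring
  linarith

theorem projLength_le_iff_of_equivInc {a₁ a₂ b₁ b₂ : EuclideanSpace ℝ (Fin 3)} {ha₁ : ‖a₁‖ ≤ 1}
    {ha₂ : ‖a₂‖ ≤ 1} {hb₁ : ‖b₁‖ ≤ 1} {hb₂ : ‖b₂‖ ≤ 1}
    (h : EquivInc (unbiasedPair a₁ a₂ ha₁ ha₂) (unbiasedPair b₁ b₂ hb₁ hb₂)) {U V W : ℝ}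
    (hn : U ^ 2 + V ^ 2 + W ^ 2 = 1) :
    projLength (diagCoord (a₁ + a₂)) U V W + projLength (diagCoord (a₁ - a₂)) U V W ≤ 2 ↔
      projLength (diagCoord (b₁ + b₂)) U V W + projLength (diagCoord (b₁ - b₂)) U V W ≤ 2 := by
  simp only [← norm_perpPart_ofDiagCoord hn]
  rw [← compatibleOn_equatorialDisc_iff (norm_ofDiagCoord hn) ha₁ ha₂,
    ← compatibleOn_equatorialDisc_iff (norm_ofDiagCoord hn) hb₁ hb₂]
  exact not_iff_not.mp ⟨h.1 _ (equatorialDisc_subset _), h.2 _ (equatorialDisc_subset _)⟩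

/-- If the sum and the difference of `b₁` and `b₂` lie along different diagonals and have length
`√2 t`, then `b₁` and `b₂` lie along the axes and have length `t`. -/
theorem eq_of_diagCoord {t : ℝ} (b₁ b₂ : EuclideanSpace ℝ (Fin 3))
    (h : (diagCoord (b₁ + b₂) 1 = 0 ∧ diagCoord (b₁ + b₂) 2 = 0 ∧ diagCoord (b₁ - b₂) 0 = 0 ∧
        diagCoord (b₁ - b₂) 2 = 0 ∧ diagCoord (b₁ + b₂) 0 ^ 2 = 2 * t ^ 2 ∧
        diagCoord (b₁ - b₂) 1 ^ 2 = 2 * t ^ 2) ∨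
      (diagCoord (b₁ + b₂) 0 = 0 ∧ diagCoord (b₁ + b₂) 2 = 0 ∧ diagCoord (b₁ - b₂) 1 = 0 ∧
        diagCoord (b₁ - b₂) 2 = 0 ∧ diagCoord (b₁ + b₂) 1 ^ 2 = 2 * t ^ 2 ∧
        diagCoord (b₁ - b₂) 0 ^ 2 = 2 * t ^ 2)) :
    ((b₁ = t • xHat ∨ b₁ = -(t • xHat)) ∧ (b₂ = t • yHat ∨ b₂ = -(t • yHat))) ∨
      ((b₁ = t • yHat ∨ b₁ = -(t • yHat)) ∧ (b₂ = t • xHat ∨ b₂ = -(t • xHat))) := by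
  have ext_iff : ∀ v w : EuclideanSpace ℝ (Fin 3), v = w ↔ v 0 = w 0 ∧ v 1 = w 1 ∧ v 2 = w 2 := by
    intro v w
    refine ⟨by rintro rfl; exact ⟨rfl, rfl, rfl⟩, fun hvw => ?_⟩
    ext i
    fin_cases i
    exacts [hvw.1, hvw.2.1, hvw.2.2]
  have hs : √2 ≠ 0 := by positivity
  have h2 : √2 ^ 2 = (2 : ℝ) := Real.sq_sqrt (by norm_num)
  have half : ∀ x : ℝ, (x / √2) ^ 2 = 2 * t ^ 2 → x = 2 * t ∨ x = -(2 * t) := by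
    intro x hx
    refine sq_eq_sq_iff_eq_or_eq_neg.mp ?_
    rw [div_pow, h2] at hx
    linarith
  simp only [ext_iff]
  simp [diagCoord, hs] at h
  simp [xHat, yHat]
  rcases h with ⟨p1, p2, p3, p4, p5, p6⟩ | ⟨p1, p2, p3, p4, p5, p6⟩ <;>
    rcases half _ p5 with q5 | q5 <;> rcases half _ p6 with q6 | q6
  · left
    refine ⟨.inl ⟨?_, ?_, ?_⟩, .inl ⟨?_, ?_, ?_⟩⟩ <;> linarith
  · right
    refine ⟨.inl ⟨?_, ?_, ?_⟩, .inl ⟨?_, ?_, ?_⟩⟩ <;> linarith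
  · right
    refine ⟨.inr ⟨?_, ?_, ?_⟩, .inr ⟨?_, ?_, ?_⟩⟩ <;> linarith
  · left
    refine ⟨.inr ⟨?_, ?_, ?_⟩, .inr ⟨?_, ?_, ?_⟩⟩ <;> linarith
  · left
    refine ⟨.inl ⟨?_, ?_, ?_⟩, .inr ⟨?_, ?_, ?_⟩⟩ <;> linarith
  · right
    refine ⟨.inr ⟨?_, ?_, ?_⟩, .inl ⟨?_, ?_, ?_⟩⟩ <;> linarith
  · right
    refine ⟨.inl ⟨?_, ?_, ?_⟩, .inr ⟨?_, ?_, ?_⟩⟩ <;> linarith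
  · left
    refine ⟨.inr ⟨?_, ?_, ?_⟩, .inl ⟨?_, ?_, ?_⟩⟩ <;> linarith

end QuantumIncompatibility

theorem theorem1 (t : ℝ) (ht : t ∈ Set.Icc (0 : ℝ) 1) (hinc : Incompatible (mubPair t ht))
    (b₁ b₂ : EuclideanSpace ℝ (Fin 3)) (hb₁ : ‖b₁‖ ≤ 1) (hb₂ : ‖b₂‖ ≤ 1) :
    EquivInc (mubPair t ht) (unbiasedPair b₁ b₂ hb₁ hb₂) ↔
      ((b₁ = t • xHat ∨ b₁ = -(t • xHat)) ∧ (b₂ = t • yHat ∨ b₂ = -(t • yHat))) ∨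
      ((b₁ = t • yHat ∨ b₁ = -(t • yHat)) ∧ (b₂ = t • xHat ∨ b₂ = -(t • xHat))) := by
  refine ⟨fun h => ?_, equivInc_unbiasedPair _ _ _ _⟩
  have hs : 1 < √2 * t := one_lt_sqrt_two_mul_of_incompatible ht hinc
  have h2 : √2 ^ 2 = (2 : ℝ) := Real.sq_sqrt (by norm_num)
  have hs2 : 0 < √2 := by positivity
  have t0 : 0 < t := pos_of_mul_pos_right (by linarith) hs2.le
  have hk : (2 / (√2 * t)) ^ 2 = 2 / t ^ 2 := by
    rw [div_pow, mul_pow, h2]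
    field_simp
  have hiff : ∀ U V W : ℝ, U ^ 2 + V ^ 2 + W ^ 2 = 1 →
      (√(1 - U ^ 2) + √(1 - V ^ 2) ≤ 2 / (√2 * t) ↔
        projLength (diagCoord (b₁ + b₂)) U V W + projLength (diagCoord (b₁ - b₂)) U V W ≤ 2) := by
    intro U V W hn
    rw [← projLength_le_iff_of_equivInc h hn, projLength_diagCoord_mub t0.le,
      le_div_iff₀' (by positivity)]
  have hfin := axes_of_projLength_eq_two (k := 2 / (√2 * t))
    (by rw [hk, le_div_iff₀ (by positivity)]; nlinarith [ht.2]) (by positivity)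
    (by rw [div_lt_iff₀ (by positivity)]; linarith) (diagCoord (b₁ + b₂)) (diagCoord (b₁ - b₂))
    (fun U V W hn hU hW hkk => projLength_add_eq_two_of_boundary _ _
      (fun U V W hn => (hiff U V W hn).2) (fun U V W hn => (hiff U V W hn).1) hn hU hW hkk)
  rw [hk, show 4 / (2 / t ^ 2) = 2 * t ^ 2 by field_simp; norm_num] at hfin
  exact eq_of_diagCoord b₁ b₂ hfin
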